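/- **Theorem 2.** Let $\kappa\in\mathbb{R}$ and let $(X,d)$ be a complete CAT($\kappa$) space; if $\kappa>0$, assume that $X$ has diameter less than $\frac{\pi}{2\sqrt{\kappa}}$. (CAT($\kappa$) is meant in the usual sense: any two points, at distance less than $\pi/\sqrt\kappa$ if $\kappa>0$, are joined by a geodesic, and in every geodesic triangle, of perimeter less than $2\pi/\sqrt\kappa$ if $\kappa>0$, the distance between two points is at most the distance between their comparison points in a comparison triangle in the complete simply connected surface of constant curvature $\kappa$. Under these assumptions $X$ is uniquely geodesic; for $x,y\in X$ and $t\in[0,1]$ we write $(1-t)x+ty$ for the point of the geodesic from $x$ to $y$ at distance $t\,d(x,y)$ from $x$.) Let $A\subset X$ be a bounded set with diameter $D$ such that for each point $x\in X$ there is at least one point of $A$ furthest from $x$, and define $F\colon X\to\mathbb{R}$ by $F(x)=\max_{a\in A}d(x,a)^2$. Let $N\ge 0$ be an integer, let $\Delta=\frac{1}{\sqrt{2(N+1)}}$, and let $x^0,x^1,\dots,x^N\in X$ be any sequence with $x^0\in A$ and, for each $k=0,\dots,N-1$, $$x^{k+1}=(1-\Delta)x^k+\Delta\,\bar a^k\quad\text{for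 some point }\bar a^k\in A\text{ furthest from }x^k.$$ Then $F$ attains its minimum on $X$, and $$\min_{k=0,\dots,N}F(x^k)-\min F\;\le\;\frac{2\sqrt{2}\,D^2}{\sqrt{N+1}}.$$ -/

import Mathlib

noncomputable section

open Set

/-- `γ`, restricted to `[0, d(x,y)]`, is a geodesic joining `x` to `y`. -/
def IsGeodesic {X : Type*} [MetricSpace X] (γ : ℝ → X) (x y : X) : Prop :=
  γ 0 = x ∧ γ (dist x y) = y ∧
    ∀ s ∈ Icc 0 (dist x y), ∀ t ∈ Icc 0 (dist x y), dist (γ s) (γ t) = |s - t|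

/-- `p` is a point `(1 - t) x + t y`: it lies on a geodesic joining `x` to `y`, at distance
`t d(x,y)` from `x`. In a uniquely geodesic space and for `t ∈ [0,1]` there is exactly one. -/
def IsGeodesicCombo {X : Type*} [MetricSpace X] (t : ℝ) (x y p : X) : Prop :=
  ∃ γ : ℝ → X, IsGeodesic γ x y ∧ p = γ (t * dist x y)

/-- The model plane of constant curvature `κ`, up to rescaling of the distance, as a surface in
`ℝ³`: the unit sphere if `κ > 0`, the upper sheet of the hyperboloid if `κ < 0`, and the flat
plane at height `1` if `κ = 0`. -/
def modelPlane (κ : ℝ) : Set (Fin 3 → ℝ) :=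
  {u | (0 < κ → u 0 ^ 2 + u 1 ^ 2 + u 2 ^ 2 = 1) ∧
       (κ = 0 → u 0 = 1) ∧
       (κ < 0 → -u 0 ^ 2 + u 1 ^ 2 + u 2 ^ 2 = -1 ∧ 0 < u 0)}

/-- The distance of the model plane of curvature `κ`: the angular distance of the sphere divided
by `√κ`, the Euclidean distance, or the hyperbolic distance divided by `√(-κ)`. -/
def modelDist (κ : ℝ) (u v : Fin 3 → ℝ) : ℝ :=
  if 0 < κ then Real.arccos (u 0 * v 0 + u 1 * v 1 + u 2 * v 2) / √κ
  else if κ < 0 then Real.arcosh (u 0 * v 0 - u 1 * v 1 - u 2 * v 2) / √(-κ)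
  else √((u 1 - v 1) ^ 2 + (u 2 - v 2) ^ 2)

/-- `w` is a comparison triangle in the model plane for the triangle with vertices `v`. -/
def IsComparisonTriangle {X : Type*} [MetricSpace X] (κ : ℝ) (v : Fin 3 → X)
    (w : Fin 3 → Fin 3 → ℝ) : Prop :=
  (∀ i, w i ∈ modelPlane κ) ∧ ∀ i j, modelDist κ (w i) (w j) = dist (v i) (v j)

/-- `p` is the point of the segment `[a, b]` of the model plane at distance `s` from `a`. -/
def IsModelSegmentPoint (κ : ℝ) (a b : Fin 3 → ℝ) (s : ℝ) (p : Fin 3 → ℝ) : Prop :=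
  p ∈ modelPlane κ ∧ modelDist κ a p = s ∧ modelDist κ p b = modelDist κ a b - s

/-- The CAT(`κ`) inequality for the geodesic triangle with vertices `v 0, v 1, v 2`, whose `i`-th
side is the geodesic `γ i` from `v i` to `v (i + 1)` (indices modulo 3): distances between points
of the triangle are at most the distances between their comparison points. -/
def CATInequality {X : Type*} [MetricSpace X] (κ : ℝ) (v : Fin 3 → X) (γ : Fin 3 → ℝ → X) :
    Prop :=
  ∀ w : Fin 3 → Fin 3 → ℝ, IsComparisonTriangle κ v w →
    ∀ i j : Fin 3, ∀ s ∈ Icc 0 (dist (v i) (v (i + 1))), ∀ t ∈ Icc 0 (dist (v j) (v (j + 1))),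
      ∀ p q : Fin 3 → ℝ, IsModelSegmentPoint κ (w i) (w (i + 1)) s p →
        IsModelSegmentPoint κ (w j) (w (j + 1)) t q →
          dist (γ i s) (γ j t) ≤ modelDist κ p q

/-- `X` is a CAT(`κ`) space: any two points (at distance less than `π/√κ` if `κ > 0`) are joined
by a geodesic, and every geodesic triangle (of perimeter less than `2π/√κ` if `κ > 0`) satisfies
the CAT(`κ`) inequality. -/
structure IsCATSpace (κ : ℝ) (X : Type*) [MetricSpace X] : Prop where
  exists_geodesic : ∀ x y : X, (0 < κ → dist x y < Real.pi / √κ) →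
    ∃ γ : ℝ → X, IsGeodesic γ x y
  cat_inequality : ∀ (v : Fin 3 → X) (γ : Fin 3 → ℝ → X),
    (∀ i, IsGeodesic (γ i) (v i) (v (i + 1))) →
    (0 < κ → dist (v 0) (v 1) + dist (v 1) (v 2) + dist (v 2) (v 0) < 2 * (Real.pi / √κ)) →
      CATInequality κ v γ

/-- `a` is a point of `A` furthest from `x`. -/
def IsFurthestPoint {X : Type*} [MetricSpace X] (A : Set X) (x a : X) : Prop :=
  a ∈ A ∧ ∀ b ∈ A, dist x b ≤ dist x a

/-- The objective `F(x) = max_{a ∈ A} d(x,a)²`. -/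
def enclosingObjective {X : Type*} [MetricSpace X] (A : Set X) (x : X) : ℝ :=
  sSup ((fun a => dist x a ^ 2) '' A)

/-- The points `x 0, …, x N` are generated by the algorithm with step sizes `t 0, …, t (N - 1)`:
it starts in `A`, and each step moves from the current point towards a furthest point of `A`. -/
def IsAlgorithmRun {X : Type*} [MetricSpace X] (A : Set X) (t : ℕ → ℝ) (N : ℕ) (x : ℕ → X) :
    Prop :=
  x 0 ∈ A ∧ ∀ k < N, ∃ a : X, IsFurthestPoint A (x k) a ∧ IsGeodesicCombo (t k) (x k) a (x (k + 1))

end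

/-!
In the Euclidean plane a step of relative length `t` from `x` towards a furthest point `a` turns
`d(x, p)²` into `d(x, p)² - t (d(x, a)² - d(a, p)²) + t² d(x, a)² - t d(x, p)²`. Without the last
term this remains an upper bound in every model plane as long as `d(a, p) ≤ d(x, a)`, which holds
for a minimiser `p` of `F`: it follows from the convexity of `w ↦ cos √w` and `w ↦ cosh √w`, and
the CAT inequality transfers it to `X`. Telescoping the resulting estimate
`t (1 - t) (F x - F p) ≤ d(x, p)² - d(z, p)² + t² F p` for a step from `x` to `z` gives the rate.
The minimiser exists because `F` is strongly midpoint convex; for `κ > 0` this is where the diameter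
has to stay strictly below `π / (2 √κ)`, so that `cos (√κ d)` is bounded away from `0`.
-/

open Real Set Filter Topology

lemma convexOn_comp_sqrt {f f' : ℝ → ℝ} {s t : Set ℝ} (hf : ∀ x, HasDerivAt f (f' x) x)
    (hf' : ConvexOn ℝ t f') (h0 : f' 0 = 0) (h0t : 0 ∈ t) (hs : Convex ℝ s) (hs0 : s ⊆ Ici 0)
    (hst : MapsTo sqrt s t) : ConvexOn ℝ s fun w => f √w := by
  have hpos : ∀ w ∈ interior s, 0 < w := fun w hw => by simpa using interior_mono hs0 hw
  have hderiv : ∀ w ∈ interior s, HasDerivAt (fun w => f √w) (f' √w / √w / 2) w := fun w hw =>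
    ((hf √w).comp w (hasDerivAt_sqrt (hpos w hw).ne')).congr_deriv (by ring)
  refine MonotoneOn.convexOn_of_deriv hs ?_
    (fun w hw => (hderiv w hw).differentiableAt.differentiableWithinAt) fun v hv w hw hvw => ?_
  · have hfc : Continuous f := continuous_iff_continuousAt.2 fun x => (hf x).continuousAt
    exact (hfc.comp continuous_sqrt).continuousOn
  · have hsecant := hf'.secant_mono h0t (hst (interior_subset hv)) (hst (interior_subset hw))
      (sqrt_pos.2 (hpos v hv)).ne' (sqrt_pos.2 (hpos w hw)).ne' (sqrt_le_sqrt hvw)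
    simp only [h0, sub_zero] at hsecant
    rw [(hderiv v hv).deriv, (hderiv w hw).deriv]
    gcongr

lemma convexOn_sinh : ConvexOn ℝ (Ici 0) sinh := by
  refine MonotoneOn.convexOn_of_deriv (convex_Ici 0) continuous_sinh.continuousOn
    differentiable_sinh.differentiableOn ?_
  rw [interior_Ici, Real.deriv_sinh]
  exact cosh_strictMonoOn.monotoneOn.mono Ioi_subset_Ici_self

lemma convexOn_cosh_sqrt : ConvexOn ℝ (Ici 0) fun w => cosh √w :=
  convexOn_comp_sqrt hasDerivAt_cosh convexOn_sinh sinh_zero self_mem_Ici (convex_Ici 0) subset_rfl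
    fun w _ => sqrt_nonneg w

lemma convexOn_cos_sqrt : ConvexOn ℝ (Icc 0 (π ^ 2)) fun w => cos √w :=
  convexOn_comp_sqrt hasDerivAt_cos strictConcaveOn_sin_Icc.concaveOn.neg (by simp)
    (left_mem_Icc.2 pi_nonneg) (convex_Icc _ _) Icc_subset_Ici_self
    fun w hw => ⟨sqrt_nonneg w, sqrt_le_iff.2 ⟨pi_nonneg, hw.2⟩⟩

lemma cos_sub_cos_le {x y : ℝ} (hx : 0 ≤ x) (hxy : x ≤ y) :
    cos x - cos y ≤ (y ^ 2 - x ^ 2) / 2 := by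
  calc cos x - cos y = 2 * (sin ((x + y) / 2) * sin ((y - x) / 2)) := by
        rw [cos_sub_cos, ← neg_sub y x, neg_div, sin_neg]; ring
    _ ≤ 2 * (|sin ((x + y) / 2)| * |sin ((y - x) / 2)|) := by
        rw [← abs_mul]; gcongr; exact le_abs_self _
    _ ≤ 2 * (|(x + y) / 2| * |(y - x) / 2|) := by
        gcongr 2 * (?_ * ?_) <;> exact abs_sin_le_abs
    _ = (y ^ 2 - x ^ 2) / 2 := by
        rw [abs_of_nonneg (by linarith), abs_of_nonneg (by linarith)]; ring

lemma cos_add_sin_mul_le_cos {x y : ℝ} (hx : 0 ≤ x) (hxy : x ≤ y) (hy : y ≤ π) :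
    cos y + sin y / y / 2 * (y ^ 2 - x ^ 2) ≤ cos x := by
  rcases hxy.eq_or_lt with rfl | hlt
  · simp
  have hy0 : 0 < y := hx.trans_lt hlt
  have hderiv : HasDerivAt (fun w => cos √w) (-(sin y / y / 2)) (y ^ 2) := by
    have h := (hasDerivAt_cos √(y ^ 2)).comp (y ^ 2) (hasDerivAt_sqrt (by positivity))
    rw [sqrt_sq hy0.le] at h
    exact h.congr_deriv (by ring)
  have hsq : x ^ 2 < y ^ 2 := by gcongr
  have hslope := convexOn_cos_sqrt.slope_le_of_hasDerivAt
    ⟨sq_nonneg x, by gcongr; exact hxy.trans hy⟩ ⟨sq_nonneg y, by gcongr⟩ hsq hderiv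
  rw [slope_def_field, div_le_iff₀ (sub_pos.2 hsq), sqrt_sq hx, sqrt_sq hy0.le] at hslope
  linarith

lemma cos_hinge_eq (a b u : ℝ) : cos a * cos b + u * (sin a * sin b) =
    (1 + u) / 2 * cos (a - b) + (1 - u) / 2 * cos (a + b) := by
  rw [cos_sub, cos_add]; ring

lemma cosh_hinge_eq (a b u : ℝ) : cosh a * cosh b - u * (sinh a * sinh b) =
    (1 + u) / 2 * cosh (a - b) + (1 - u) / 2 * cosh (a + b) := by
  rw [cosh_sub, cosh_add]; ring

lemma sq_hinge_eq (a b u : ℝ) : a ^ 2 + b ^ 2 - 2 * a * b * u =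
    (1 + u) / 2 * (a - b) ^ 2 + (1 - u) / 2 * (a + b) ^ 2 := by
  ring

section UnitCurvature

variable {a b u : ℝ}

lemma sq_hinge_nonneg (hu : u ∈ Icc (-1) 1) : 0 ≤ a ^ 2 + b ^ 2 - 2 * a * b * u := by
  rw [sq_hinge_eq]
  have h₁ : 0 ≤ 1 + u := by linarith [hu.1]
  have h₂ : 0 ≤ 1 - u := by linarith [hu.2]
  positivity

lemma one_le_cosh_hinge (hu : u ∈ Icc (-1) 1) : 1 ≤ cosh a * cosh b - u * (sinh a * sinh b) := by
  rw [cosh_hinge_eq]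
  nlinarith [hu.1, hu.2, one_le_cosh (a - b), one_le_cosh (a + b)]

lemma cos_hinge_mem_Icc (hu : u ∈ Icc (-1) 1) :
    cos a * cos b + u * (sin a * sin b) ∈ Icc (-1) 1 := by
  rw [cos_hinge_eq]
  constructor <;> nlinarith [hu.1, hu.2, neg_one_le_cos (a - b), neg_one_le_cos (a + b),
    cos_le_one (a - b), cos_le_one (a + b)]

lemma cos_sqrt_hinge_le (ha : 0 ≤ a) (hb : 0 ≤ b) (hab : a + b ≤ π) (hu : u ∈ Icc (-1) 1) :
    cos √(a ^ 2 + b ^ 2 - 2 * a * b * u) ≤ cos a * cos b + u * (sin a * sin b) := by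
  have hadd : (a + b) ^ 2 ≤ π ^ 2 := by gcongr
  have hsub : (a - b) ^ 2 ≤ (a + b) ^ 2 := by nlinarith [mul_nonneg ha hb]
  have hconv := convexOn_cos_sqrt.2 ⟨sq_nonneg (a - b), hsub.trans hadd⟩ ⟨sq_nonneg (a + b), hadd⟩
    (show 0 ≤ (1 + u) / 2 by linarith [hu.1]) (show 0 ≤ (1 - u) / 2 by linarith [hu.2]) (by ring)
  simp only [smul_eq_mul, sqrt_sq_eq_abs, cos_abs] at hconv
  rwa [sq_hinge_eq, cos_hinge_eq]

lemma cosh_sqrt_hinge_le (hu : u ∈ Icc (-1) 1) :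
    cosh √(a ^ 2 + b ^ 2 - 2 * a * b * u) ≤ cosh a * cosh b - u * (sinh a * sinh b) := by
  have hconv := convexOn_cosh_sqrt.2 (mem_Ici.2 (sq_nonneg (a - b)))
    (mem_Ici.2 (sq_nonneg (a + b))) (show 0 ≤ (1 + u) / 2 by linarith [hu.1])
    (show 0 ≤ (1 - u) / 2 by linarith [hu.2]) (by ring)
  simp only [smul_eq_mul, sqrt_sq_eq_abs, cosh_abs] at hconv
  rwa [sq_hinge_eq, cosh_hinge_eq]

lemma exists_cosh_hinge_add_eq {r : ℝ} (hu : u ∈ Icc (-1) 1)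
    (hr : cosh r = cosh a * cosh b - u * (sinh a * sinh b)) :
    ∃ v ∈ Icc (-1) 1, ∀ h, cosh (a + h) * cosh b - u * (sinh (a + h) * sinh b) =
      cosh h * cosh r - v * (sinh h * sinh r) := by
  set w := u * (cosh a * sinh b) - sinh a * cosh b
  have hw : w ^ 2 ≤ sinh r ^ 2 := by
    have hdiff : sinh r ^ 2 - w ^ 2 = (1 - u ^ 2) * sinh b ^ 2 := by
      rw [sinh_sq r, hr]
      linear_combination (cosh b ^ 2 - u ^ 2 * sinh b ^ 2) * cosh_sq a + cosh_sq b
    have hu2 : 0 ≤ 1 - u ^ 2 := by nlinarith [hu.1, hu.2]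
    linarith [mul_nonneg hu2 (sq_nonneg (sinh b))]
  have hv : w / sinh r * sinh r = w :=
    div_mul_cancel_of_imp fun h0 => by simpa [h0, sq_nonpos_iff] using hw
  refine ⟨w / sinh r, abs_le.1 ?_, fun h => ?_⟩
  · rw [abs_div]
    exact div_le_one_of_le₀ (sq_le_sq.1 hw) (abs_nonneg _)
  · rw [cosh_add, sinh_add, hr]
    linear_combination sinh h * hv

lemma sq_sub_le_of_cos_hinge_eq {r : ℝ} (ha : 0 ≤ a) (ha' : a ≤ π / 2) (hb : 0 ≤ b)
    (hb' : b < π) (hr : 0 ≤ r) (hra : r ≤ a)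
    (h : cos r = cos a * cos b + u * (sin a * sin b)) : a ^ 2 - 2 * a * b * u ≤ r ^ 2 := by
  rcases ha.eq_or_lt with rfl | ha0
  · nlinarith
  have htangent : sin a / a / 2 * (a ^ 2 - r ^ 2) ≤ sin a / a / 2 * (2 * a * (u * sin b)) := by
    have hcos : cos a * cos b ≤ cos a :=
      mul_le_of_le_one_right (cos_nonneg_of_mem_Icc ⟨by linarith, ha'⟩) (cos_le_one b)
    have htan := cos_add_sin_mul_le_cos hr hra (by linarith [pi_pos])
    have hexp : sin a / a / 2 * (2 * a * (u * sin b)) = u * (sin a * sin b) := by field_simp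
    linarith
  have hsin : 0 < sin a := sin_pos_of_pos_of_lt_pi ha0 (by linarith [pi_pos])
  have hgap : a ^ 2 - r ^ 2 ≤ 2 * a * (u * sin b) := le_of_mul_le_mul_left htangent (by positivity)
  have hle : u * sin b ≤ u * b := by
    rcases hb.eq_or_lt with rfl | hb0
    · simp
    have hu : 0 ≤ u := by
      have hsq : r ^ 2 ≤ a ^ 2 := by gcongr
      exact nonneg_of_mul_nonneg_left (b := sin b) (by nlinarith) (sin_pos_of_pos_of_lt_pi hb0 hb')
    exact mul_le_mul_of_nonneg_left (sin_le hb) hu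
  nlinarith

lemma sq_add_le_of_cos_add_cos_le {l d r ρ g : ℝ} (hl : |l / 2| ≤ π) (hd : |d| ≤ π) (hr : |r| ≤ π)
    (hρ : 0 ≤ ρ) (hρ' : ρ ≤ π) (hg : 0 ≤ g) (hgρ : g ≤ cos ρ)
    (h : cos d + cos r ≤ 2 * cos (l / 2) * cos ρ) :
    ρ ^ 2 + g / π ^ 2 * l ^ 2 ≤ (d ^ 2 + r ^ 2) / 2 := by
  set w := (d ^ 2 + r ^ 2) / 2
  have hd2 : d ^ 2 ≤ π ^ 2 := sq_le_sq.2 (by rwa [abs_of_pos pi_pos])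
  have hr2 : r ^ 2 ≤ π ^ 2 := sq_le_sq.2 (by rwa [abs_of_pos pi_pos])
  have hgap : g / π ^ 2 * l ^ 2 / 2 ≤ cos ρ - cos √w := by
    have hconv := convexOn_cos_sqrt.2 ⟨sq_nonneg d, hd2⟩ ⟨sq_nonneg r, hr2⟩
      (show (0 : ℝ) ≤ 1 / 2 by norm_num) (show (0 : ℝ) ≤ 1 / 2 by norm_num) (by norm_num)
    simp only [smul_eq_mul, sqrt_sq_eq_abs, cos_abs] at hconv
    rw [show 1 / 2 * d ^ 2 + 1 / 2 * r ^ 2 = w by ring] at hconv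
    have hcos := mul_le_mul_of_nonneg_right (cos_le_one_sub_mul_cos_sq hl) (hg.trans hgρ)
    have hmono := mul_le_mul_of_nonneg_right hgρ (show 0 ≤ 2 / π ^ 2 * (l / 2) ^ 2 by positivity)
    rw [show g / π ^ 2 * l ^ 2 / 2 = g * (2 / π ^ 2 * (l / 2) ^ 2) by ring]
    linarith
  have hle : ρ ≤ √w := by
    by_contra! hlt
    have hcos := cos_lt_cos_of_nonneg_of_le_pi (sqrt_nonneg w) hρ' hlt
    have : 0 ≤ g / π ^ 2 * l ^ 2 / 2 := by positivity
    linarith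
  have hsub := cos_sub_cos_le hρ hle
  rw [sq_sqrt (by positivity)] at hsub
  linarith

end UnitCurvature

section ModelPlane

/-- The point of the model plane with polar coordinates: distance `r` from the pole and angle
`arccos u` to a fixed ray. The angle is recorded by its cosine. -/
noncomputable def modelPolar (κ r u : ℝ) : Fin 3 → ℝ :=
  if 0 < κ then ![cos (√κ * r), u * sin (√κ * r), √(1 - u ^ 2) * sin (√κ * r)]
  else if κ < 0 then ![cosh (√(-κ) * r), u * sinh (√(-κ) * r), √(1 - u ^ 2) * sinh (√(-κ) * r)]
  else ![1, u * r, √(1 - u ^ 2) * r]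

/-- The length of the side of a hinge in the model plane that is opposite to the vertex, where `a`
and `b` are the other two sides and `u` is the cosine of the angle between them. -/
noncomputable def hingeSide (κ a b u : ℝ) : ℝ :=
  modelDist κ (modelPolar κ a 1) (modelPolar κ b u)

lemma modelDist_comm (κ : ℝ) (v w : Fin 3 → ℝ) : modelDist κ v w = modelDist κ w v := by
  simp only [modelDist, mul_comm (v _), sub_sq_comm (v _)]

lemma modelDist_self {κ : ℝ} {v : Fin 3 → ℝ} (hv : v ∈ modelPlane κ) : modelDist κ v v = 0 := by
  obtain ⟨hpos, -, hneg⟩ := hv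
  unfold modelDist
  split_ifs with hκ hκ'
  · rw [show v 0 * v 0 + v 1 * v 1 + v 2 * v 2 = 1 by linarith [hpos hκ], arccos_one, zero_div]
  · rw [show v 0 * v 0 - v 1 * v 1 - v 2 * v 2 = 1 by linarith [(hneg hκ').1], arcosh_zero,
      zero_div]
  · simp

variable {κ a b u : ℝ}

lemma modelPolar_mem_modelPlane (r : ℝ) (hu : u ∈ Icc (-1) 1) :
    modelPolar κ r u ∈ modelPlane κ := by
  have hsq : √(1 - u ^ 2) ^ 2 = 1 - u ^ 2 := sq_sqrt (by nlinarith [hu.1, hu.2])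
  refine ⟨fun hκ => ?_, ?_, fun hκ => ?_⟩
  · simp only [modelPolar, if_pos hκ, Matrix.cons_val]
    linear_combination sin (√κ * r) ^ 2 * hsq + cos_sq_add_sin_sq (√κ * r)
  · rintro rfl
    simp [modelPolar]
  · simp only [modelPolar, if_pos hκ, if_neg hκ.not_gt, Matrix.cons_val]
    exact ⟨by linear_combination sinh (√(-κ) * r) ^ 2 * hsq - cosh_sq (√(-κ) * r), cosh_pos _⟩

lemma hingeSide_of_pos (hκ : 0 < κ) : hingeSide κ a b u =
    arccos (cos (√κ * a) * cos (√κ * b) + u * (sin (√κ * a) * sin (√κ * b))) / √κ := by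
  simp only [hingeSide, modelDist, modelPolar, if_pos hκ, Matrix.cons_val]
  ring_nf

lemma hingeSide_of_neg (hκ : κ < 0) : hingeSide κ a b u =
    arcosh (cosh (√(-κ) * a) * cosh (√(-κ) * b) - u * (sinh (√(-κ) * a) * sinh (√(-κ) * b))) /
      √(-κ) := by
  simp only [hingeSide, modelDist, modelPolar, if_pos hκ, if_neg hκ.not_gt, Matrix.cons_val]
  ring_nf

lemma hingeSide_zero (hu : u ∈ Icc (-1) 1) :
    hingeSide 0 a b u = √(a ^ 2 + b ^ 2 - 2 * a * b * u) := by
  have hsq : √(1 - u ^ 2) ^ 2 = 1 - u ^ 2 := sq_sqrt (by nlinarith [hu.1, hu.2])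
  simp only [hingeSide, modelDist, modelPolar, lt_irrefl, if_false, Matrix.cons_val]
  congr 1
  ring_nf
  rw [hsq]
  ring

lemma cos_sqrt_mul_hingeSide (hκ : 0 < κ) (hu : u ∈ Icc (-1) 1) : cos (√κ * hingeSide κ a b u) =
    cos (√κ * a) * cos (√κ * b) + u * (sin (√κ * a) * sin (√κ * b)) := by
  rw [hingeSide_of_pos hκ, mul_div_cancel₀ _ (sqrt_pos.2 hκ).ne',
    cos_arccos (cos_hinge_mem_Icc hu).1 (cos_hinge_mem_Icc hu).2]

lemma cosh_sqrt_mul_hingeSide (hκ : κ < 0) (hu : u ∈ Icc (-1) 1) :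
    cosh (√(-κ) * hingeSide κ a b u) =
      cosh (√(-κ) * a) * cosh (√(-κ) * b) - u * (sinh (√(-κ) * a) * sinh (√(-κ) * b)) := by
  rw [hingeSide_of_neg hκ, mul_div_cancel₀ _ (sqrt_pos.2 (neg_pos.2 hκ)).ne',
    cosh_arcosh (one_le_cosh_hinge hu)]

lemma sqrt_mul_hingeSide_le_pi (hκ : 0 < κ) : √κ * hingeSide κ a b u ≤ π := by
  rw [hingeSide_of_pos hκ, mul_div_cancel₀ _ (sqrt_pos.2 hκ).ne']
  exact arccos_le_pi _

lemma hingeSide_nonneg (hu : u ∈ Icc (-1) 1) : 0 ≤ hingeSide κ a b u := by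
  rcases lt_trichotomy κ 0 with hκ | rfl | hκ
  · rw [hingeSide_of_neg hκ]
    exact div_nonneg (arcosh_nonneg (one_le_cosh_hinge hu)) (sqrt_nonneg _)
  · rw [hingeSide_zero hu]
    exact sqrt_nonneg _
  · rw [hingeSide_of_pos hκ]
    exact div_nonneg (arccos_nonneg _) (sqrt_nonneg _)

lemma hingeSide_eq_of_pos {c : ℝ} (hκ : 0 < κ) (hc : 0 ≤ c) (hc' : √κ * c ≤ π)
    (h : cos (√κ * a) * cos (√κ * b) + u * (sin (√κ * a) * sin (√κ * b)) = cos (√κ * c)) :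
    hingeSide κ a b u = c := by
  rw [hingeSide_of_pos hκ, h, arccos_cos (by positivity) hc',
    mul_div_cancel_left₀ _ (sqrt_pos.2 hκ).ne']

lemma hingeSide_eq_of_neg {c : ℝ} (hκ : κ < 0) (hc : 0 ≤ c)
    (h : cosh (√(-κ) * a) * cosh (√(-κ) * b) - u * (sinh (√(-κ) * a) * sinh (√(-κ) * b)) =
      cosh (√(-κ) * c)) : hingeSide κ a b u = c := by
  rw [hingeSide_of_neg hκ, h, arcosh_cosh (by positivity),
    mul_div_cancel_left₀ _ (sqrt_pos.2 (neg_pos.2 hκ)).ne']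

lemma hingeSide_zero_left (hb : 0 ≤ b) (hb' : 0 < κ → √κ * b ≤ π) (hu : u ∈ Icc (-1) 1) :
    hingeSide κ 0 b u = b := by
  rcases lt_trichotomy κ 0 with hκ | rfl | hκ
  · exact hingeSide_eq_of_neg hκ hb (by simp)
  · simp [hingeSide_zero hu, sqrt_sq hb]
  · exact hingeSide_eq_of_pos hκ hb (hb' hκ) (by simp)

lemma hingeSide_one (ha : 0 < κ → √κ * |a - b| ≤ π) : hingeSide κ a b 1 = |a - b| := by
  have habs (c : ℝ) : √c * |a - b| = |√c * a - √c * b| := by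
    rw [← mul_sub, abs_mul, abs_of_nonneg (sqrt_nonneg c)]
  rcases lt_trichotomy κ 0 with hκ | rfl | hκ
  · exact hingeSide_eq_of_neg hκ (abs_nonneg _) (by rw [habs, cosh_abs, cosh_sub, one_mul])
  · rw [hingeSide_zero (by simp), ← sqrt_sq_eq_abs]
    ring_nf
  · exact hingeSide_eq_of_pos hκ (abs_nonneg _) (ha hκ) (by rw [habs, cos_abs, cos_sub, one_mul])

lemma hingeSide_neg_one (hab : 0 ≤ a + b) (hab' : 0 < κ → √κ * (a + b) ≤ π) :
    hingeSide κ a b (-1) = a + b := by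
  rcases lt_trichotomy κ 0 with hκ | rfl | hκ
  · exact hingeSide_eq_of_neg hκ hab (by rw [mul_add, cosh_add]; ring)
  · rw [hingeSide_zero (by simp), ← sqrt_sq hab]
    ring_nf
  · exact hingeSide_eq_of_pos hκ hab (hab' hκ) (by rw [mul_add, cos_add]; ring)

lemma continuousOn_hingeSide : ContinuousOn (fun u => hingeSide κ a b u) (Icc (-1) 1) := by
  rcases lt_trichotomy κ 0 with hκ | rfl | hκ
  · simp only [hingeSide_of_neg hκ]
    exact (continuousOn_arcosh.comp (by fun_prop) fun u hu => one_le_cosh_hinge hu).div_const _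
  · refine ContinuousOn.congr (f := fun u => √(a ^ 2 + b ^ 2 - 2 * a * b * u)) (by fun_prop) ?_
    exact fun u hu => hingeSide_zero hu
  · simp only [hingeSide_of_pos hκ]
    exact ((continuous_arccos.comp (by fun_prop)).div_const _).continuousOn

lemma exists_hingeSide_eq {c : ℝ} (ha : 0 ≤ a) (hb : 0 ≤ b) (hab : 0 < κ → √κ * (a + b) ≤ π)
    (hc : |a - b| ≤ c) (hc' : c ≤ a + b) : ∃ u ∈ Icc (-1) 1, hingeSide κ a b u = c := by
  have hone : hingeSide κ a b 1 = |a - b| := hingeSide_one fun hκ =>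
    (mul_le_mul_of_nonneg_left (hc.trans hc') (sqrt_nonneg κ)).trans (hab hκ)
  have hneg : hingeSide κ a b (-1) = a + b := hingeSide_neg_one (by positivity) hab
  exact intermediate_value_Icc' (by norm_num) continuousOn_hingeSide
    ⟨hone.le.trans hc, hc'.trans hneg.ge⟩

end ModelPlane

section HingeComparison

variable {κ a b u : ℝ}

lemma hingeSide_sq_le_of_pos (hκ : 0 < κ) (ha : 0 ≤ a) (hb : 0 ≤ b) (hab : √κ * (a + b) ≤ π)
    (hu : u ∈ Icc (-1) 1) : hingeSide κ a b u ^ 2 ≤ a ^ 2 + b ^ 2 - 2 * a * b * u := by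
  have hκ' : 0 < √κ := sqrt_pos.2 hκ
  have hcos := cos_sqrt_hinge_le (mul_nonneg hκ'.le ha) (mul_nonneg hκ'.le hb)
    (by rwa [← mul_add]) hu
  have hle : √κ * hingeSide κ a b u ≤
      √((√κ * a) ^ 2 + (√κ * b) ^ 2 - 2 * (√κ * a) * (√κ * b) * u) := by
    by_contra! hlt
    rw [← cos_sqrt_mul_hingeSide hκ hu] at hcos
    exact hcos.not_gt (cos_lt_cos_of_nonneg_of_le_pi (sqrt_nonneg _) (sqrt_mul_hingeSide_le_pi hκ)
      hlt)
  rw [le_sqrt (mul_nonneg hκ'.le (hingeSide_nonneg hu)) (sq_hinge_nonneg hu)] at hle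
  refine le_of_mul_le_mul_left ?_ (pow_pos hκ' 2)
  linarith

lemma sq_sub_le_hingeSide_sq_of_pos (hκ : 0 < κ) (ha : 0 ≤ a) (ha' : √κ * a ≤ π / 2) (hb : 0 ≤ b)
    (hb' : √κ * b < π) (hu : u ∈ Icc (-1) 1) (h : hingeSide κ a b u ≤ a) :
    a ^ 2 - 2 * a * b * u ≤ hingeSide κ a b u ^ 2 := by
  have hκ' : 0 < √κ := sqrt_pos.2 hκ
  have hscaled := sq_sub_le_of_cos_hinge_eq (by positivity) ha' (by positivity) hb'
    (mul_nonneg hκ'.le (hingeSide_nonneg hu)) (by gcongr) (cos_sqrt_mul_hingeSide hκ hu)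
  refine le_of_mul_le_mul_left ?_ (pow_pos hκ' 2)
  linarith

lemma cos_add_cos_hingeSide (hκ : 0 < κ) (hu : u ∈ Icc (-1) 1) :
    cos (√κ * b) + cos (√κ * hingeSide κ a b u) =
      2 * cos (√κ * a / 2) * cos (√κ * hingeSide κ (1 / 2 * a) b u) := by
  rw [cos_sqrt_mul_hingeSide hκ hu, cos_sqrt_mul_hingeSide hκ hu,
    show √κ * a = 2 * (√κ * a / 2) by ring, show √κ * (1 / 2 * a) = √κ * a / 2 by ring,
    cos_two_mul, sin_two_mul]
  ring_nf

lemma le_hingeSide_sq_of_neg (hκ : κ < 0) (hu : u ∈ Icc (-1) 1) :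
    a ^ 2 + b ^ 2 - 2 * a * b * u ≤ hingeSide κ a b u ^ 2 := by
  have hκ' : 0 < √(-κ) := sqrt_pos.2 (neg_pos.2 hκ)
  have hcosh := cosh_sqrt_hinge_le (a := √(-κ) * a) (b := √(-κ) * b) hu
  rw [← cosh_sqrt_mul_hingeSide hκ hu, cosh_le_cosh, abs_of_nonneg (sqrt_nonneg _),
    abs_of_nonneg (mul_nonneg hκ'.le (hingeSide_nonneg hu)), sqrt_le_iff] at hcosh
  refine le_of_mul_le_mul_left ?_ (pow_pos hκ' 2)
  linarith [hcosh.2]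

lemma exists_hingeSide_add_eq_of_neg (hκ : κ < 0) (hu : u ∈ Icc (-1) 1) :
    ∃ v ∈ Icc (-1) 1, ∀ h, hingeSide κ (a + h) b u = hingeSide κ h (hingeSide κ a b u) v := by
  obtain ⟨v, hv, hrebase⟩ := exists_cosh_hinge_add_eq hu (cosh_sqrt_mul_hingeSide hκ hu)
  refine ⟨v, hv, fun h => ?_⟩
  rw [hingeSide_of_neg hκ, hingeSide_of_neg hκ (a := h), mul_add, hrebase]

lemma hingeSide_mul_sq_le_of_nonpos {t : ℝ} (hκ : κ ≤ 0) (hb : 0 ≤ b) (ht : t ∈ Icc 0 1)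
    (hu : u ∈ Icc (-1) 1) : hingeSide κ (t * a) b u ^ 2 ≤
      (1 - t) * b ^ 2 + t * hingeSide κ a b u ^ 2 - t * (1 - t) * a ^ 2 := by
  rcases hκ.eq_or_lt with rfl | hκ
  · simp only [hingeSide_zero hu, sq_sqrt (sq_hinge_nonneg hu)]
    exact le_of_eq (by ring)
  obtain ⟨v, hv, hrebase⟩ := exists_hingeSide_add_eq_of_neg (a := t * a) (b := b) hκ hu
  have hstart := le_hingeSide_sq_of_neg (a := -(t * a)) (b := hingeSide κ (t * a) b u) hκ hv
  have hend := le_hingeSide_sq_of_neg (a := a - t * a) (b := hingeSide κ (t * a) b u) hκ hv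
  rw [← hrebase, add_neg_cancel, hingeSide_zero_left hb (fun h => absurd h hκ.not_gt) hu] at hstart
  rw [← hrebase, add_sub_cancel] at hend
  linarith [mul_le_mul_of_nonneg_left hstart (sub_nonneg.2 ht.2),
    mul_le_mul_of_nonneg_left hend ht.1]

lemma hingeSide_mul_sq_le {t : ℝ} (ha : 0 ≤ a) (hb : 0 ≤ b)
    (hab : 0 < κ → √κ * a ≤ π / 2 ∧ √κ * b ≤ π / 2) (ht : t ∈ Icc 0 1) (hu : u ∈ Icc (-1) 1)
    (h : hingeSide κ a b u ≤ a) :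
    hingeSide κ (t * a) b u ^ 2 ≤
      b ^ 2 - t * (a ^ 2 - hingeSide κ a b u ^ 2) + t ^ 2 * a ^ 2 := by
  rcases le_or_gt κ 0 with hκ | hκ
  · linarith [hingeSide_mul_sq_le_of_nonpos (a := a) hκ hb ht hu, mul_nonneg ht.1 (sq_nonneg b)]
  · obtain ⟨ha', hb'⟩ := hab hκ
    have hta : √κ * (t * a) ≤ √κ * a := by
      gcongr
      exact mul_le_of_le_one_left ha ht.2
    have hupper := hingeSide_sq_le_of_pos hκ (mul_nonneg ht.1 ha) hb
      (by rw [mul_add]; linarith) hu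
    have hlower := mul_le_mul_of_nonneg_left
      (sq_sub_le_hingeSide_sq_of_pos hκ ha ha' hb (by linarith [pi_pos]) hu h) ht.1
    linarith

end HingeComparison

lemma isModelSegmentPoint_modelPolar {κ s l : ℝ} (hs : s ∈ Icc 0 l) (hl : 0 < κ → √κ * l ≤ π) :
    IsModelSegmentPoint κ (modelPolar κ 0 1) (modelPolar κ l 1) s (modelPolar κ s 1) := by
  have hone : (1 : ℝ) ∈ Icc (-1) 1 := by simp
  have hle {c : ℝ} (hc : c ≤ l) (hκ : 0 < κ) : √κ * c ≤ π :=
    (mul_le_mul_of_nonneg_left hc (sqrt_nonneg κ)).trans (hl hκ)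
  have habs : |s - l| = l - s := by rw [abs_sub_comm, abs_of_nonneg (sub_nonneg.2 hs.2)]
  refine ⟨modelPolar_mem_modelPlane s hone, hingeSide_zero_left hs.1 (hle hs.2) hone, ?_⟩
  calc hingeSide κ s l 1 = l - s := by rw [hingeSide_one (habs ▸ hle (sub_le_self l hs.1)), habs]
    _ = hingeSide κ 0 l 1 - s := by rw [hingeSide_zero_left (hs.1.trans hs.2) hl hone]

lemma isComparisonTriangle_modelPolar {X : Type*} [MetricSpace X] {κ u : ℝ} {x a y : X}
    (hxa : 0 < κ → √κ * dist x a ≤ π) (hxy : 0 < κ → √κ * dist x y ≤ π) (hu : u ∈ Icc (-1) 1)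
    (hay : hingeSide κ (dist x a) (dist x y) u = dist a y) :
    IsComparisonTriangle κ ![x, a, y]
      ![modelPolar κ 0 1, modelPolar κ (dist x a) 1, modelPolar κ (dist x y) u] := by
  have hone : (1 : ℝ) ∈ Icc (-1) 1 := by simp
  have h₀₁ : modelDist κ (modelPolar κ 0 1) (modelPolar κ (dist x a) 1) = dist x a :=
    hingeSide_zero_left dist_nonneg hxa hone
  have h₀₂ : modelDist κ (modelPolar κ 0 1) (modelPolar κ (dist x y) u) = dist x y :=
    hingeSide_zero_left dist_nonneg hxy hu
  have h₁₂ : modelDist κ (modelPolar κ (dist x a) 1) (modelPolar κ (dist x y) u) = dist a y := hay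
  refine ⟨fun i => ?_, fun i j => ?_⟩
  · fin_cases i <;> simp [modelPolar_mem_modelPlane, hu]
  · fin_cases i <;> fin_cases j <;>
      simp [modelDist_self, modelPolar_mem_modelPlane, hu, h₀₁, h₀₂, h₁₂, dist_comm a x,
        dist_comm y, modelDist_comm κ (modelPolar κ (dist x a) 1) (modelPolar κ 0 1),
        modelDist_comm κ (modelPolar κ (dist x y) u)]

namespace IsCATSpace

variable {X : Type*} [MetricSpace X] {κ : ℝ}

lemma exists_isGeodesic (hX : IsCATSpace κ X) (hd : 0 < κ → ∀ x y : X, √κ * dist x y < π / 2)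
    (x y : X) : ∃ γ, IsGeodesic γ x y :=
  hX.exists_geodesic x y fun hκ => by
    rw [lt_div_iff₀' (sqrt_pos.2 hκ)]
    linarith [hd hκ x y, pi_pos]

lemma dist_le_modelDist (hX : IsCATSpace κ X) (hd : 0 < κ → ∀ x y : X, √κ * dist x y < π / 2)
    {x a : X} {γ : ℝ → X} (hγ : IsGeodesic γ x a) (y : X) {s : ℝ} (hs : s ∈ Icc 0 (dist x a))
    {w₀ w₁ w₂ p : Fin 3 → ℝ} (hw : IsComparisonTriangle κ ![x, a, y] ![w₀, w₁, w₂])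
    (hp : IsModelSegmentPoint κ w₀ w₁ s p) : dist (γ s) y ≤ modelDist κ p w₂ := by
  obtain ⟨γ₁, hγ₁⟩ := hX.exists_isGeodesic hd a y
  obtain ⟨γ₂, hγ₂⟩ := hX.exists_isGeodesic hd y x
  have hgeo (i : Fin 3) : IsGeodesic (![γ, γ₁, γ₂] i) (![x, a, y] i) (![x, a, y] (i + 1)) := by
    fin_cases i <;> assumption
  have hperimeter (hκ : 0 < κ) : dist x a + dist a y + dist y x < 2 * (π / √κ) := by
    rw [← mul_div_assoc, lt_div_iff₀' (sqrt_pos.2 hκ)]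
    linarith [hd hκ x a, hd hκ a y, hd hκ y x, pi_pos]
  have hvertex : IsModelSegmentPoint κ w₂ w₀ 0 w₂ :=
    ⟨hw.1 2, modelDist_self (hw.1 2), (sub_zero _).symm⟩
  have hcat := hX.cat_inequality _ _ hgeo hperimeter _ hw 0 2 s hs 0 ⟨le_rfl, dist_nonneg⟩ p w₂ hp
    hvertex
  rwa [show ![γ, γ₁, γ₂] 2 0 = y from hγ₂.1] at hcat

lemma exists_dist_le_hingeSide (hX : IsCATSpace κ X)
    (hd : 0 < κ → ∀ x y : X, √κ * dist x y < π / 2) {x a : X} {γ : ℝ → X} (hγ : IsGeodesic γ x a)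
    (y : X) : ∃ u ∈ Icc (-1) 1, hingeSide κ (dist x a) (dist x y) u = dist a y ∧
      ∀ s ∈ Icc 0 (dist x a), dist (γ s) y ≤ hingeSide κ s (dist x y) u := by
  have hd' (p q : X) (hκ : 0 < κ) : √κ * dist p q ≤ π := by linarith [hd hκ p q, pi_pos]
  obtain ⟨u, hu, hside⟩ := exists_hingeSide_eq (dist_nonneg (x := x) (y := a))
    (dist_nonneg (x := x) (y := y)) (fun hκ => by linarith [hd hκ x a, hd hκ x y])
    (abs_sub_le_iff.2 ⟨by linarith [dist_triangle_right x a y], by linarith [dist_triangle x a y]⟩)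
    (dist_triangle_left a y x)
  have hw := isComparisonTriangle_modelPolar (hd' x a) (hd' x y) hu hside
  exact ⟨u, hu, hside, fun s hs =>
    hX.dist_le_modelDist hd hγ y hs hw (isModelSegmentPoint_modelPolar hs (hd' x a))⟩

lemma dist_sq_step_le (hX : IsCATSpace κ X) (hd : 0 < κ → ∀ x y : X, √κ * dist x y < π / 2)
    {x a y : X} {γ : ℝ → X} (hγ : IsGeodesic γ x a) {t : ℝ} (ht : t ∈ Icc 0 1)
    (hy : dist a y ≤ dist x a) : dist (γ (t * dist x a)) y ^ 2 ≤
      dist x y ^ 2 - t * (dist x a ^ 2 - dist a y ^ 2) + t ^ 2 * dist x a ^ 2 := by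
  obtain ⟨u, hu, hside, hle⟩ := hX.exists_dist_le_hingeSide hd hγ y
  have hcmp : dist (γ (t * dist x a)) y ≤ hingeSide κ (t * dist x a) (dist x y) u :=
    hle _ ⟨mul_nonneg ht.1 dist_nonneg, mul_le_of_le_one_left dist_nonneg ht.2⟩
  rw [← hside] at hy ⊢
  exact (pow_le_pow_left₀ dist_nonneg hcmp 2).trans (hingeSide_mul_sq_le dist_nonneg dist_nonneg
    (fun hκ => ⟨(hd hκ x a).le, (hd hκ x y).le⟩) ht hu hy)

lemma dist_midpoint_sq_add_le_of_nonpos (hX : IsCATSpace κ X) (hκ : κ ≤ 0) {x a : X}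
    {γ : ℝ → X} (hγ : IsGeodesic γ x a) (y : X) :
    dist (γ (1 / 2 * dist x a)) y ^ 2 + 1 / 4 * dist x a ^ 2 ≤
      (dist x y ^ 2 + dist a y ^ 2) / 2 := by
  obtain ⟨u, hu, hside, hle⟩ := hX.exists_dist_le_hingeSide (fun h => absurd h hκ.not_gt) hγ y
  have hcmp := pow_le_pow_left₀ dist_nonneg
    (hle (1 / 2 * dist x a) ⟨by positivity, by linarith [dist_nonneg (x := x) (y := a)]⟩) 2
  have hstewart := hingeSide_mul_sq_le_of_nonpos (t := 1 / 2) (a := dist x a) hκ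
    (dist_nonneg (x := x) (y := y)) (by norm_num [mem_Icc]) hu
  rw [hside] at hstewart
  linarith

lemma dist_midpoint_sq_add_le_of_pos (hX : IsCATSpace κ X) (hκ : 0 < κ) {δ : ℝ} (hδ : δ < π / 2)
    (hd : ∀ x y : X, √κ * dist x y ≤ δ) {x a : X} {γ : ℝ → X} (hγ : IsGeodesic γ x a) (y : X) :
    dist (γ (1 / 2 * dist x a)) y ^ 2 + cos δ / π ^ 2 * dist x a ^ 2 ≤
      (dist x y ^ 2 + dist a y ^ 2) / 2 := by
  have hκ' : 0 < √κ := sqrt_pos.2 hκ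
  have hd₀ (p q : X) : 0 ≤ √κ * dist p q := by positivity
  have hd' (p q : X) : √κ * dist p q < π / 2 := (hd p q).trans_lt hδ
  have habs (p q : X) : |√κ * dist p q| ≤ π := by
    rw [abs_of_nonneg (hd₀ p q)]
    linarith [hd' p q, pi_pos]
  set m := γ (1 / 2 * dist x a)
  obtain ⟨u, hu, hside, hle⟩ := hX.exists_dist_le_hingeSide (fun _ => hd') hγ y
  have hcmp : dist m y ≤ hingeSide κ (1 / 2 * dist x a) (dist x y) u :=
    hle _ ⟨by positivity, by linarith [dist_nonneg (x := x) (y := a)]⟩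
  have hcos : cos (√κ * dist x y) + cos (√κ * dist a y) ≤
      2 * cos (√κ * dist x a / 2) * cos (√κ * dist m y) := by
    rw [← hside, cos_add_cos_hingeSide hκ hu]
    have hhalf : 0 ≤ cos (√κ * dist x a / 2) :=
      cos_nonneg_of_mem_Icc ⟨by linarith [hd₀ x a, pi_pos], by linarith [hd' x a, hd₀ x a]⟩
    have hmono : cos (√κ * hingeSide κ (1 / 2 * dist x a) (dist x y) u) ≤ cos (√κ * dist m y) :=
      cos_le_cos_of_nonneg_of_le_pi (hd₀ m y) (sqrt_mul_hingeSide_le_pi hκ) (by gcongr)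
    gcongr
  have hscaled := sq_add_le_of_cos_add_cos_le (g := cos δ) (l := √κ * dist x a)
    (abs_le.2 ⟨by linarith [hd₀ x a, pi_pos], by linarith [hd' x a, hd₀ x a]⟩)
    (habs x y) (habs a y) (hd₀ m y) (by linarith [hd' m y, pi_pos])
    (cos_nonneg_of_mem_Icc ⟨by linarith [hd₀ x a, hd x a, pi_pos], hδ.le⟩)
    (cos_le_cos_of_nonneg_of_le_pi (hd₀ m y) (by linarith [pi_pos]) (hd m y)) hcos
  refine le_of_mul_le_mul_left ?_ (pow_pos hκ' 2)
  linarith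

lemma exists_midpoint_dist_sq_add_le (hX : IsCATSpace κ X) {δ : ℝ} (hδ : δ < π / 2)
    (hd : 0 < κ → ∀ x y : X, √κ * dist x y ≤ δ) : ∃ c > 0, ∀ x a : X, ∃ m, ∀ y,
      dist m y ^ 2 + c * dist x a ^ 2 ≤ (dist x y ^ 2 + dist a y ^ 2) / 2 := by
  have hgeo := hX.exists_isGeodesic fun hκ x y => (hd hκ x y).trans_lt hδ
  choose γ hγ using hgeo
  rcases le_or_gt κ 0 with hκ | hκ
  · exact ⟨1 / 4, by norm_num, fun x a =>
      ⟨_, hX.dist_midpoint_sq_add_le_of_nonpos hκ (hγ x a)⟩⟩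
  rcases isEmpty_or_nonempty X with hX' | ⟨⟨x⟩⟩
  · exact ⟨1, one_pos, isEmptyElim⟩
  have hcos : 0 < cos δ := cos_pos_of_mem_Ioo ⟨by
    linarith [hd hκ x x, mul_nonneg (sqrt_nonneg κ) (dist_nonneg (x := x) (y := x)), pi_pos], hδ⟩
  exact ⟨cos δ / π ^ 2, by positivity, fun x a =>
    ⟨_, hX.dist_midpoint_sq_add_le_of_pos hκ hδ (hd hκ) (hγ x a)⟩⟩

end IsCATSpace

lemma exists_forall_le_of_midpoint {X : Type*} [PseudoMetricSpace X] [CompleteSpace X] [Nonempty X]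
    {H : X → ℝ} (hH : LowerSemicontinuous H) (hbdd : BddBelow (range H)) {c : ℝ} (hc : 0 < c)
    (hmid : ∀ x y, ∃ m, H m + c * dist x y ^ 2 ≤ (H x + H y) / 2) : ∃ x, ∀ y, H x ≤ H y := by
  set I := sInf (range H)
  have hI (y : X) : I ≤ H y := csInf_le hbdd (mem_range_self y)
  have hlim : Tendsto (fun n : ℕ => 1 / ((n : ℝ) + 1)) atTop (𝓝 0) :=
    tendsto_one_div_add_atTop_nhds_zero_nat
  have hex (n : ℕ) : ∃ x, H x < I + 1 / ((n : ℝ) + 1) := by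
    obtain ⟨_, ⟨x, rfl⟩, hx⟩ := exists_lt_of_csInf_lt (range_nonempty H)
      (lt_add_of_pos_right I (Nat.one_div_pos_of_nat (α := ℝ) (n := n)))
    exact ⟨x, hx⟩
  choose s hs using hex
  have hs_le {n k : ℕ} (hn : k ≤ n) : H (s n) ≤ I + 1 / ((k : ℝ) + 1) :=
    (hs n).le.trans (add_le_add_right (Nat.one_div_le_one_div hn) I)
  have hcauchy : CauchySeq s := by
    refine cauchySeq_of_le_tendsto_0 (fun n : ℕ => √(1 / ((n : ℝ) + 1) / c)) ?_ ?_
    · intro n m k hn hm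
      obtain ⟨z, hz⟩ := hmid (s n) (s m)
      refine le_sqrt_of_sq_le ?_
      rw [le_div_iff₀' hc]
      linarith [hI z, hs_le hn, hs_le hm]
    · simpa using (hlim.div_const c).sqrt
  obtain ⟨x, hx⟩ := cauchySeq_tendsto_of_complete hcauchy
  refine ⟨x, fun y => le_trans (le_of_forall_lt_imp_le_of_dense fun b hb => ?_) (hI y)⟩
  have hlimI : Tendsto (fun n : ℕ => I + 1 / ((n : ℝ) + 1)) atTop (𝓝 I) := by
    simpa only [add_zero] using hlim.const_add I
  refine ge_of_tendsto hlimI ?_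
  filter_upwards [hx.eventually (hH x b hb)] with n hn using (hn.trans (hs n)).le

section EnclosingObjective

variable {X : Type*} [MetricSpace X] {A : Set X} {x a b : X}

lemma enclosingObjective_eq (ha : IsFurthestPoint A x a) :
    enclosingObjective A x = dist x a ^ 2 := by
  refine IsGreatest.csSup_eq ⟨mem_image_of_mem _ ha.1, ?_⟩
  rintro _ ⟨b, hb, rfl⟩
  exact pow_le_pow_left₀ dist_nonneg (ha.2 b hb) 2

lemma dist_sq_le_enclosingObjective (ha : IsFurthestPoint A x a) (hb : b ∈ A) :
    dist x b ^ 2 ≤ enclosingObjective A x := by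
  rw [enclosingObjective_eq ha]
  exact pow_le_pow_left₀ dist_nonneg (ha.2 b hb) 2

lemma enclosingObjective_nonneg (A : Set X) (x : X) : 0 ≤ enclosingObjective A x :=
  sSup_nonneg (by rintro _ ⟨b, -, rfl⟩; positivity)

lemma enclosingObjective_le_diam_sq (hA : Bornology.IsBounded A) (hx : x ∈ A) :
    enclosingObjective A x ≤ Metric.diam A ^ 2 := by
  refine csSup_le (Set.Nonempty.image _ ⟨x, hx⟩) ?_
  rintro _ ⟨b, hb, rfl⟩
  exact pow_le_pow_left₀ dist_nonneg (Metric.dist_le_diam_of_mem hA hx hb) 2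

lemma lowerSemicontinuous_enclosingObjective (hfar : ∀ x, ∃ a, IsFurthestPoint A x a) :
    LowerSemicontinuous (enclosingObjective A) := by
  intro x r hr
  obtain ⟨a, ha⟩ := hfar x
  rw [enclosingObjective_eq ha] at hr
  have hcont : Continuous fun y => dist y a ^ 2 := by fun_prop
  filter_upwards [hcont.continuousAt.eventually (lt_mem_nhds hr)] with y hy
  obtain ⟨b, hb⟩ := hfar y
  exact hy.trans_le (dist_sq_le_enclosingObjective hb ha.1)

end EnclosingObjective

namespace IsCATSpace

variable {X : Type*} [MetricSpace X] {κ : ℝ} {A : Set X}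

lemma exists_enclosingObjective_le [CompleteSpace X] [Nonempty X] (hX : IsCATSpace κ X) {δ : ℝ}
    (hδ : δ < π / 2) (hd : 0 < κ → ∀ x y : X, √κ * dist x y ≤ δ)
    (hfar : ∀ x, ∃ a, IsFurthestPoint A x a) :
    ∃ p, ∀ y, enclosingObjective A p ≤ enclosingObjective A y := by
  obtain ⟨c, hc, hmid⟩ := hX.exists_midpoint_dist_sq_add_le hδ hd
  refine exists_forall_le_of_midpoint (lowerSemicontinuous_enclosingObjective hfar)
    ⟨0, forall_mem_range.2 (enclosingObjective_nonneg A)⟩ hc fun x y => ?_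
  obtain ⟨m, hm⟩ := hmid x y
  obtain ⟨a, ha⟩ := hfar m
  obtain ⟨b, hb⟩ := hfar x
  obtain ⟨e, he⟩ := hfar y
  refine ⟨m, ?_⟩
  rw [enclosingObjective_eq ha]
  linarith [hm a, dist_sq_le_enclosingObjective hb ha.1, dist_sq_le_enclosingObjective he ha.1]

lemma dist_sq_add_mul_sub_le (hX : IsCATSpace κ X) (hd : 0 < κ → ∀ x y : X, √κ * dist x y < π / 2)
    (hfar : ∀ x, ∃ a, IsFurthestPoint A x a) {x a p z : X} (ha : IsFurthestPoint A x a)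
    (hp : enclosingObjective A p ≤ enclosingObjective A x) {t : ℝ} (ht : t ∈ Icc 0 1)
    (hz : IsGeodesicCombo t x a z) :
    dist z p ^ 2 + t * (1 - t) * (enclosingObjective A x - enclosingObjective A p) ≤
      dist x p ^ 2 + t ^ 2 * enclosingObjective A p := by
  obtain ⟨γ, hγ, rfl⟩ := hz
  obtain ⟨b, hb⟩ := hfar p
  have hpa : dist a p ^ 2 ≤ enclosingObjective A p :=
    dist_comm a p ▸ dist_sq_le_enclosingObjective hb ha.1
  have hxa := enclosingObjective_eq ha
  have hap : dist a p ≤ dist x a := le_of_sq_le_sq (hxa ▸ hpa.trans hp) dist_nonneg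
  have hstep := hX.dist_sq_step_le hd hγ ht hap
  rw [← hxa] at hstep
  linarith [mul_le_mul_of_nonneg_left hpa ht.1]

lemma dist_sq_add_sum_le (hX : IsCATSpace κ X) (hd : 0 < κ → ∀ x y : X, √κ * dist x y < π / 2)
    (hfar : ∀ x, ∃ a, IsFurthestPoint A x a) {p : X}
    (hp : ∀ x, enclosingObjective A p ≤ enclosingObjective A x) {t : ℕ → ℝ}
    (ht : ∀ k, t k ∈ Icc 0 1) {x : ℕ → X} {N : ℕ} (hx : IsAlgorithmRun A t N x) :
    dist (x N) p ^ 2 + ∑ k ∈ Finset.range N,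
        t k * (1 - t k) * (enclosingObjective A (x k) - enclosingObjective A p) ≤
      (1 + ∑ k ∈ Finset.range N, t k ^ 2) * enclosingObjective A p := by
  induction N with
  | zero =>
    obtain ⟨b, hb⟩ := hfar p
    simpa [dist_comm p] using dist_sq_le_enclosingObjective hb hx.1
  | succ N ih =>
    have hprev := ih ⟨hx.1, fun k hk => hx.2 k (hk.trans N.lt_succ_self)⟩
    obtain ⟨a, ha, hcombo⟩ := hx.2 N N.lt_succ_self
    have hstep := hX.dist_sq_add_mul_sub_le hd hfar ha (hp (x N)) (ht N) hcombo
    rw [Finset.sum_range_succ, Finset.sum_range_succ]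
    linarith

lemma sum_step_mul_sub_le (hX : IsCATSpace κ X) (hd : 0 < κ → ∀ x y : X, √κ * dist x y < π / 2)
    (hfar : ∀ x, ∃ a, IsFurthestPoint A x a) {p : X}
    (hp : ∀ x, enclosingObjective A p ≤ enclosingObjective A x) {t : ℕ → ℝ}
    (ht : ∀ k, t k ∈ Icc 0 1) {x : ℕ → X} {N : ℕ} (hx : IsAlgorithmRun A t N x) :
    ∑ k ∈ Finset.range (N + 1),
        t k * (1 - t k) * (enclosingObjective A (x k) - enclosingObjective A p) ≤
      (1 + ∑ k ∈ Finset.range (N + 1), t k ^ 2) * enclosingObjective A p := by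
  -- The run itself stops at `x N`; a further step from there accounts for the term `k = N`.
  obtain ⟨a, ha⟩ := hfar (x N)
  obtain ⟨γ, hγ⟩ := hX.exists_isGeodesic hd (x N) a
  have hstep := hX.dist_sq_add_mul_sub_le hd hfar ha (hp (x N)) (ht N) ⟨γ, hγ, rfl⟩
  rw [Finset.sum_range_succ, Finset.sum_range_succ]
  linarith [hX.dist_sq_add_sum_le hd hfar hp ht hx, sq_nonneg (dist (γ (t N * dist (x N) a)) p)]

lemma mul_inf'_enclosingObjective_sub_le (hX : IsCATSpace κ X)
    (hd : 0 < κ → ∀ x y : X, √κ * dist x y < π / 2) (hfar : ∀ x, ∃ a, IsFurthestPoint A x a)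
    {p : X} (hp : ∀ x, enclosingObjective A p ≤ enclosingObjective A x) {τ : ℝ} (hτ : τ ∈ Icc 0 1)
    {x : ℕ → X} {N : ℕ} (hx : IsAlgorithmRun A (fun _ => τ) N x) :
    (N + 1) * (τ * (1 - τ) * ((Finset.range (N + 1)).inf' Finset.nonempty_range_add_one
        (fun k => enclosingObjective A (x k)) - enclosingObjective A p)) ≤
      (1 + (N + 1) * τ ^ 2) * enclosingObjective A p := by
  have hterm : ∀ k ∈ Finset.range (N + 1),
      τ * (1 - τ) * ((Finset.range (N + 1)).inf' Finset.nonempty_range_add_one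
        (fun k => enclosingObjective A (x k)) - enclosingObjective A p) ≤
      τ * (1 - τ) * (enclosingObjective A (x k) - enclosingObjective A p) := fun k hk =>
    mul_le_mul_of_nonneg_left (sub_le_sub_right (Finset.inf'_le _ hk) _)
      (mul_nonneg hτ.1 (sub_nonneg.2 hτ.2))
  have hsum := (Finset.card_nsmul_le_sum _ _ _ hterm).trans
    (hX.sum_step_mul_sub_le hd hfar hp (fun _ => hτ) hx)
  simpa using hsum

end IsCATSpace

lemma exists_sqrt_mul_dist_le {X : Type*} [MetricSpace X] {κ : ℝ}
    (hdiam : 0 < κ → Bornology.IsBounded (univ : Set X) ∧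
      Metric.diam (univ : Set X) < π / (2 * √κ)) :
    ∃ δ < π / 2, 0 < κ → ∀ x y : X, √κ * dist x y ≤ δ := by
  rcases le_or_gt κ 0 with hκ | hκ
  · exact ⟨0, by positivity, fun h => absurd h hκ.not_gt⟩
  obtain ⟨hbdd, hlt⟩ := hdiam hκ
  have hκ' : 0 < √κ := sqrt_pos.2 hκ
  refine ⟨√κ * Metric.diam (univ : Set X), ?_, fun _ x y => ?_⟩
  · rw [lt_div_iff₀ (by positivity)] at hlt
    linarith
  · gcongr
    exact Metric.dist_le_diam_of_mem hbdd (mem_univ x) (mem_univ y)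

lemma le_four_mul_mul {n τ M F D : ℝ} (hτ : 0 ≤ τ) (hn : n * (2 * τ ^ 2) = 1)
    (hM : n * (τ * (1 - τ) * M) ≤ (1 + n * τ ^ 2) * F) (hFD : F ≤ D) (hMD : M ≤ D) :
    M ≤ 4 * τ * D := by
  have hrate : (1 - τ) * M ≤ 3 * τ * D := by
    calc (1 - τ) * M = 2 * τ * (n * (τ * (1 - τ) * M)) := by linear_combination -(1 - τ) * M * hn
      _ ≤ 2 * τ * ((1 + n * τ ^ 2) * F) := by gcongr
      _ = 3 * τ * F := by linear_combination τ * F * hn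
      _ ≤ 3 * τ * D := by gcongr
  linarith [mul_le_mul_of_nonneg_left hMD hτ]

lemma two_mul_sqrt_two_mul_div_sqrt {n D : ℝ} (hn : 0 < n) :
    2 * √2 * D / √n = 4 * (1 / √(2 * n)) * D := by
  have hsqrt2 : √2 ^ 2 = (2 : ℝ) := sq_sqrt zero_le_two
  rw [sqrt_mul zero_le_two]
  field_simp
  linear_combination 2 * D * hsqrt2

theorem theorem2 {X : Type*} [MetricSpace X] [CompleteSpace X] (κ : ℝ)
    (hX : IsCATSpace κ X)
    (hdiam : 0 < κ → Bornology.IsBounded (Set.univ : Set X) ∧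
      Metric.diam (Set.univ : Set X) < Real.pi / (2 * √κ))
    (A : Set X) (hA : Bornology.IsBounded A)
    (hfar : ∀ x : X, ∃ a : X, IsFurthestPoint A x a)
    (N : ℕ) (x : ℕ → X)
    (hx : IsAlgorithmRun A (fun _ => 1 / √(2 * ((N : ℝ) + 1))) N x) :
    ∃ m : ℝ, IsLeast (Set.range (enclosingObjective A)) m ∧
      (Finset.range (N + 1)).inf' Finset.nonempty_range_add_one
          (fun k => enclosingObjective A (x k)) - m ≤
        2 * √2 * Metric.diam A ^ 2 / √((N : ℝ) + 1) := by
  have : Nonempty X := ⟨x 0⟩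
  obtain ⟨δ, hδ, hd⟩ := exists_sqrt_mul_dist_le hdiam
  obtain ⟨p, hp⟩ := hX.exists_enclosingObjective_le hδ hd hfar
  refine ⟨enclosingObjective A p, ⟨mem_range_self p, forall_mem_range.2 hp⟩, ?_⟩
  set τ := 1 / √(2 * ((N : ℝ) + 1)) with hτ_def
  have hτ : 0 ≤ τ := by positivity
  have hτ_sq : ((N : ℝ) + 1) * (2 * τ ^ 2) = 1 := by
    rw [hτ_def, div_pow, sq_sqrt (by positivity)]
    field_simp
  have hτ_mem : τ ∈ Icc 0 1 := ⟨hτ, by nlinarith [(Nat.cast_nonneg N : (0 : ℝ) ≤ N)]⟩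
  have hrate := hX.mul_inf'_enclosingObjective_sub_le (fun hκ x y => (hd hκ x y).trans_lt hδ)
    hfar hp hτ_mem hx
  have hstart := enclosingObjective_le_diam_sq hA hx.1
  have hbest := Finset.inf'_le (fun k => enclosingObjective A (x k))
    (Finset.mem_range.2 N.succ_pos)
  rw [two_mul_sqrt_two_mul_div_sqrt (by positivity)]
  exact le_four_mul_mul hτ hτ_sq hrate ((hp (x 0)).trans hstart)
    (by linarith [enclosingObjective_nonneg A p])
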